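/- **Theorem.** The conjugate encryption scheme is $\lambda\log_2\!\left(1+\tfrac{1}{\sqrt2}\right)$-uncloneable secure. Moreover, for every cloning attack and every $\lambda\ge 1$, the winning probability is at most $\left(\tfrac12+\tfrac1{2\sqrt2}\right)^{\lambda}$. Here $\mathcal Q(n)=(\mathbb C^2)^{\otimes n}$, bit strings $s$ are identified with the computational basis states $|s\rangle\langle s|$, and $|x^\theta\rangle=H^{\theta_1}|x_1\rangle\otimes\cdots\otimes H^{\theta_n}|x_n\rangle$ with $H$ the Hadamard operator. *Schemes.* A quantum encryption of classical messages consists, for each $\lambda\in\mathbb N^+$, of sizes $n,\kappa,\ell$ and completely positive trace-preserving maps $Key$ (from $\mathbb C$ to $\mathcal Q(\kappa)$), $Enc$ (from $\mathcal Q(\kappa)\otimes\mathcal Q(n)$ to $\mathcal Q(\ell)$) and $Dec$ (from $\mathcal Q(\kappa)\otimes\mathcal Q(\ell)$ to $\mathcal Q(n)$) such that, writing $Enc_k(\rho)=Enc(|k\rangle\langle k|\otimes\rho)$ and similarly for other maps, $\mathrm{Tr}[|m\rangle\langle m|\,Dec_k(Enc_k(|m\rangle\langle m|))]=1$ for every message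 $m$ and every key $k$ with $\Pr[\mathcal K=k]:=\mathrm{Tr}[|k\rangle\langle k|\,Key(1)]>0$. *Attacks.* A cloning attack consists, for each $\lambda$, of completely positive trace-preserving maps $A$ (from $\mathcal Q(\ell)$ to $\mathcal Q(\beta)\otimes\mathcal Q(\gamma)$), $B$ (from $\mathcal Q(\kappa)\otimes\mathcal Q(\beta)$ to $\mathcal Q(n)$) and $C$ (from $\mathcal Q(\kappa)\otimes\mathcal Q(\gamma)$ to $\mathcal Q(n)$), for some sizes $\beta(\lambda),\gamma(\lambda)$; no computational restriction is imposed, so that in particular all attacks by efficient quantum circuits are included. Its winning probability is $$\mathop{\mathbb E}_{m}\ \mathop{\mathbb E}_{k\leftarrow\mathcal K}\ \mathrm{Tr}\big[(|m\rangle\langle m|\otimes|m\rangle\langle m|)\,(B_k\otimes C_k)\circ A\circ Enc_k(|m\rangle\langle m|)\big],$$ with $m\in\{0,1\}^n$ uniform. The scheme is $t(\lambda)$-uncloneable secure if for every cloning attack there is a negligible function $\eta$ such that the winning probability is at most $2^{-n(\lambda)+t(\lambda)}+\eta(\lambda)$ for all $\lambda$. *Conjugate encryption.* $n=\ell=\lambda$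 and $\kappa=2\lambda$. $Key$ outputs a uniformly random $(r,\theta)\in\{0,1\}^\lambda\times\{0,1\}^\lambda$; $Enc$ maps $(r,\theta)$ and $m$ to $|(m\oplus r)^\theta\rangle\langle(m\oplus r)^\theta|$; $Dec$ applies $H^{\theta_1}\otimes\cdots\otimes H^{\theta_\lambda}$ to the ciphertext, measures it in the computational basis with result $c$, and outputs $c\oplus r$. -/

import Mathlib

open scoped Kronecker ComplexOrder

namespace QuantumEnc

/-! ### Qubit registers, states and channels

A finite-dimensional Hilbert space with a distinguished orthonormal basis indexed by a finite
type `a` is `a → ℂ`; operators on it are matrices indexed by `a`, and the tensor product of two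
such spaces is indexed by the product type, with the Kronecker product of operators. -/

/-- Bit strings of length `n`. They index the computational basis of the space of `n` qubits. -/
abbrev Bits (n : ℕ) : Type := Fin n → Bool

/-- Bitwise exclusive or. -/
def bxor {n : ℕ} (x y : Bits n) : Bits n := fun i => xor (x i) (y i)

/-- Operators on the Hilbert space with basis `a`. -/
abbrev Op (a : Type) : Type := Matrix a a ℂ

/-- The basis vector `|s⟩`. -/
def ket {a : Type} [DecidableEq a] (s : a) : a → ℂ := Pi.single s 1

/-- The operator `|ψ⟩⟨φ|`. -/
def outer {a b : Type} (ψ : b → ℂ) (φ : a → ℂ) : Matrix b a ℂ := Matrix.vecMulVec ψ (star φ)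

/-- The operator `|ψ⟩⟨ψ|`. -/
def ketbra {a : Type} (ψ : a → ℂ) : Op a := outer ψ ψ

/-- The map `id ⊗ Φ` on operators of the tensor product of spaces with bases `e` and `a`. -/
def idTensor (e : Type) {a b : Type} (Φ : Op a →ₗ[ℂ] Op b) : Op (e × a) →ₗ[ℂ] Op (e × b) where
  toFun ρ := Matrix.of fun p q => Φ (Matrix.of fun x y => ρ (p.1, x) (q.1, y)) p.2 q.2
  map_add' ρ σ := by
    ext p q
    have h : (Matrix.of fun x y => (ρ + σ) (p.1, x) (q.1, y))
        = (Matrix.of fun x y => ρ (p.1, x) (q.1, y)) +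
          (Matrix.of fun x y => σ (p.1, x) (q.1, y)) := by ext; rfl
    change Φ (Matrix.of fun x y => (ρ + σ) (p.1, x) (q.1, y)) p.2 q.2 = _
    rw [h, map_add]
    rfl
  map_smul' c ρ := by
    ext p q
    have h : (Matrix.of fun x y => (c • ρ) (p.1, x) (q.1, y))
        = c • (Matrix.of fun x y => ρ (p.1, x) (q.1, y)) := by ext; rfl
    change Φ (Matrix.of fun x y => (c • ρ) (p.1, x) (q.1, y)) p.2 q.2 = _
    rw [h, map_smul]
    rfl

/-- The map `Φ ⊗ id` on operators of the tensor product of spaces with bases `a` and `e`. -/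
def tensorId (e : Type) {a b : Type} (Φ : Op a →ₗ[ℂ] Op b) : Op (a × e) →ₗ[ℂ] Op (b × e) where
  toFun ρ := Matrix.of fun p q => Φ (Matrix.of fun x y => ρ (x, p.2) (y, q.2)) p.1 q.1
  map_add' ρ σ := by
    ext p q
    have h : (Matrix.of fun x y => (ρ + σ) (x, p.2) (y, q.2))
        = (Matrix.of fun x y => ρ (x, p.2) (y, q.2)) +
          (Matrix.of fun x y => σ (x, p.2) (y, q.2)) := by ext; rfl
    change Φ (Matrix.of fun x y => (ρ + σ) (x, p.2) (y, q.2)) p.1 q.1 = _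
    rw [h, map_add]
    rfl
  map_smul' c ρ := by
    ext p q
    have h : (Matrix.of fun x y => (c • ρ) (x, p.2) (y, q.2))
        = c • (Matrix.of fun x y => ρ (x, p.2) (y, q.2)) := by ext; rfl
    change Φ (Matrix.of fun x y => (c • ρ) (x, p.2) (y, q.2)) p.1 q.1 = _
    rw [h, map_smul]
    rfl

/-- The tensor product `Φ ⊗ Ψ = (Φ ⊗ id) ∘ (id ⊗ Ψ)` of two linear maps between operator
spaces. -/
def mapTensor {a b c d : Type} (Φ : Op a →ₗ[ℂ] Op b) (Ψ : Op c →ₗ[ℂ] Op d) :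
    Op (a × c) →ₗ[ℂ] Op (b × d) :=
  tensorId d Φ ∘ₗ idTensor a Ψ

/-- The defining property of the tensor product of maps. -/
theorem mapTensor_kronecker {a b c d : Type} (Φ : Op a →ₗ[ℂ] Op b) (Ψ : Op c →ₗ[ℂ] Op d)
    (ρ : Op a) (σ : Op c) : mapTensor Φ Ψ (ρ ⊗ₖ σ) = Φ ρ ⊗ₖ Ψ σ := by
  have h1 : idTensor a Ψ (ρ ⊗ₖ σ) = ρ ⊗ₖ Ψ σ := by
    ext p q
    have h : (Matrix.of fun x y => (ρ ⊗ₖ σ) (p.1, x) (q.1, y)) = ρ p.1 q.1 • σ := by ext; rfl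
    change Ψ (Matrix.of fun x y => (ρ ⊗ₖ σ) (p.1, x) (q.1, y)) p.2 q.2 = _
    rw [h, map_smul]
    rfl
  have h2 : tensorId d Φ (ρ ⊗ₖ Ψ σ) = Φ ρ ⊗ₖ Ψ σ := by
    ext p q
    have h : (Matrix.of fun x y => (ρ ⊗ₖ Ψ σ) (x, p.2) (y, q.2)) = Ψ σ p.2 q.2 • ρ := by
      ext x y
      exact mul_comm _ _
    change Φ (Matrix.of fun x y => (ρ ⊗ₖ Ψ σ) (x, p.2) (y, q.2)) p.1 q.1 = _
    rw [h, map_smul]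
    exact mul_comm _ _
  rw [mapTensor, LinearMap.comp_apply, h1, h2]

/-- Completely positive trace-preserving maps. -/
structure CPTP (a b : Type) [Fintype a] [Fintype b] where
  /-- the underlying linear map -/
  map : Op a →ₗ[ℂ] Op b
  completely_positive : ∀ (k : ℕ) (ρ : Op (Fin k × a)), ρ.PosSemidef →
    (idTensor (Fin k) map ρ).PosSemidef
  trace_preserving : ∀ ρ : Op a, (map ρ).trace = ρ.trace

/-- The linear map `ρ ↦ ∑ i, Kᵢ ρ Kᵢ†`. -/
def krausMap {ι a b : Type} [Fintype ι] [Fintype a] (K : ι → Matrix b a ℂ) :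
    Op a →ₗ[ℂ] Op b where
  toFun ρ := ∑ i, K i * ρ * (K i).conjTranspose
  map_add' ρ σ := by
    simp only [Matrix.mul_add, Matrix.add_mul, Finset.sum_add_distrib]
  map_smul' c ρ := by
    simp only [Matrix.mul_smul, Matrix.smul_mul, Finset.smul_sum, RingHom.id_apply]

theorem krausMap_apply {ι a b : Type} [Fintype ι] [Fintype a] (K : ι → Matrix b a ℂ) (ρ : Op a) :
    krausMap K ρ = ∑ i, K i * ρ * (K i).conjTranspose := rfl

theorem idTensor_krausMap {ι a b : Type} [Fintype ι] [Fintype a] (k : ℕ)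
    (K : ι → Matrix b a ℂ) (ρ : Op (Fin k × a)) :
    idTensor (Fin k) (krausMap K) ρ =
      ∑ i, ((1 : Op (Fin k)) ⊗ₖ K i) * ρ * ((1 : Op (Fin k)) ⊗ₖ K i).conjTranspose := by
  ext p q
  change krausMap K (Matrix.of fun x y => ρ (p.1, x) (q.1, y)) p.2 q.2 = _
  rw [krausMap_apply, Matrix.sum_apply, Matrix.sum_apply]
  refine Finset.sum_congr rfl fun i _ => ?_
  simp [Matrix.mul_apply, Fintype.sum_prod_type, Matrix.kroneckerMap_apply, Matrix.one_apply,
    ite_mul, Finset.sum_ite_eq, apply_ite]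

/-- The channel `ρ ↦ ∑ i, Kᵢ ρ Kᵢ†` given by Kraus operators with `∑ i, Kᵢ† Kᵢ = 1`. -/
def CPTP.ofKraus {ι a b : Type} [Fintype ι] [Fintype a] [DecidableEq a] [Fintype b]
    (K : ι → Matrix b a ℂ) (hK : ∑ i, (K i).conjTranspose * K i = 1) : CPTP a b where
  map := krausMap K
  completely_positive k ρ hρ := by
    rw [idTensor_krausMap]
    exact Matrix.posSemidef_sum _ fun i _ => hρ.mul_mul_conjTranspose_same _
  trace_preserving ρ := by
    rw [krausMap_apply, Matrix.trace_sum]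
    calc ∑ i, (K i * ρ * (K i).conjTranspose).trace
        = ∑ i, ((K i).conjTranspose * K i * ρ).trace := by
          refine Finset.sum_congr rfl fun i _ => ?_
          rw [Matrix.trace_mul_comm, Matrix.mul_assoc]
      _ = ρ.trace := by
          rw [← Matrix.trace_sum, ← Finset.sum_mul, hK, Matrix.one_mul]

/-- For a channel `Φ` whose input is a key register and a second register, and a key `k`, the map
`Φ_k : ρ ↦ Φ (|k⟩⟨k| ⊗ ρ)`. -/
def CPTP.keyed {κ : ℕ} {a b : Type} [Fintype a] [Fintype b] (Φ : CPTP (Bits κ × a) b)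
    (k : Bits κ) : Op a →ₗ[ℂ] Op b where
  toFun ρ := Φ.map (ketbra (ket k) ⊗ₖ ρ)
  map_add' ρ σ := by rw [Matrix.kronecker_add, map_add]
  map_smul' c ρ := by rw [Matrix.kronecker_smul, map_smul, RingHom.id_apply]

/-! ### Quantum encryption of classical messages and uncloneable security -/

/-- A quantum encryption of classical messages, indexed by the security parameter: the key
generation, encryption and decryption channels, where decryption recovers every message under
every key that has a positive probability of being generated. -/
structure QECM where
  /-- message size -/
  n : ℕ+ → ℕ
  /-- key size -/
  κ : ℕ+ → ℕ
  /-- ciphertext size -/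
  ℓ : ℕ+ → ℕ
  Key : ∀ lam, CPTP (Bits 0) (Bits (κ lam))
  Enc : ∀ lam, CPTP (Bits (κ lam) × Bits (n lam)) (Bits (ℓ lam))
  Dec : ∀ lam, CPTP (Bits (κ lam) × Bits (ℓ lam)) (Bits (n lam))
  correct : ∀ (lam : ℕ+) (k : Bits (κ lam)) (m : Bits (n lam)),
    0 < (ketbra (ket k) * (Key lam).map 1).trace.re →
    (ketbra (ket m) *
      (Dec lam).keyed k ((Enc lam).keyed k (ketbra (ket m)))).trace = 1

/-- The probability that the key `k` is generated. -/
def QECM.keyProb (S : QECM) (lam : ℕ+) (k : Bits (S.κ lam)) : ℝ :=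
  (ketbra (ket k) * (S.Key lam).map 1).trace.re

/-- A cloning attack: a channel `A` that splits the ciphertext into two registers, and channels
`B`, `C` that try to recover the message from the key and one of the registers each. The channels
are arbitrary: no bound is put on the resources of the attackers. -/
structure CloningAttack (S : QECM) where
  β : ℕ+ → ℕ
  γ : ℕ+ → ℕ
  A : ∀ lam, CPTP (Bits (S.ℓ lam)) (Bits (β lam) × Bits (γ lam))
  B : ∀ lam, CPTP (Bits (S.κ lam) × Bits (β lam)) (Bits (S.n lam))
  C : ∀ lam, CPTP (Bits (S.κ lam) × Bits (γ lam)) (Bits (S.n lam))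

/-- The winning probability of a cloning attack, for a uniformly random message:
`𝔼_m 𝔼_{k ← Key} Tr[(|m⟩⟨m| ⊗ |m⟩⟨m|) (B_k ⊗ C_k)(A (Enc_k |m⟩⟨m|))]`. -/
noncomputable def CloningAttack.winProb {S : QECM} (𝒜 : CloningAttack S) (lam : ℕ+) : ℝ :=
  (1 / 2 ^ S.n lam) * ∑ m : Bits (S.n lam), ∑ k : Bits (S.κ lam), S.keyProb lam k *
    ((ketbra (ket m) ⊗ₖ ketbra (ket m)) *
      mapTensor ((𝒜.B lam).keyed k) ((𝒜.C lam).keyed k)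
        ((𝒜.A lam).map ((S.Enc lam).keyed k (ketbra (ket m))))).trace.re

/-- Negligible functions of the security parameter. -/
def Negligible (η : ℕ+ → ℝ) : Prop :=
  ∀ c : ℕ, ∃ N : ℕ+, ∀ lam : ℕ+, N ≤ lam → |η lam| ≤ 1 / ((lam : ℕ) : ℝ) ^ c

/-- `t`-uncloneable security. -/
def QECM.UncloneableSecure (S : QECM) (t : ℕ+ → ℝ) : Prop :=
  ∀ 𝒜 : CloningAttack S, ∃ η : ℕ+ → ℝ, Negligible η ∧
    ∀ lam : ℕ+, 𝒜.winProb lam ≤ (2 : ℝ) ^ (-(S.n lam : ℝ) + t lam) + η lam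

/-! ### Wiesner states and conjugate encryption -/

/-- The one-qubit operator `H ^ θ`, where `H` is the Hadamard operator. -/
noncomputable def hadamard (θ : Bool) : Matrix Bool Bool ℂ :=
  Matrix.of fun y x =>
    if θ then (if x && y then -1 else 1) / (Real.sqrt 2 : ℂ) else (if y = x then 1 else 0)

/-- The `n`-qubit operator `H ^ θ₁ ⊗ ⋯ ⊗ H ^ θₙ`. -/
noncomputable def hadamardPow {n : ℕ} (θ : Bits n) : Op (Bits n) :=
  Matrix.of fun y x => ∏ i, hadamard (θ i) (y i) (x i)

/-- The Wiesner state `|x^θ⟩ = H ^ θ₁ |x₁⟩ ⊗ ⋯ ⊗ H ^ θₙ |xₙ⟩`. -/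
noncomputable def wiesner {n : ℕ} (x θ : Bits n) : Bits n → ℂ :=
  (hadamardPow θ).mulVec (ket x)

/-- The first half `r` of a key `(r, θ)`. -/
def keyR {n : ℕ} (k : Bits (n + n)) : Bits n := fun i => k (Fin.castAdd n i)

/-- The second half `θ` of a key `(r, θ)`. -/
def keyθ {n : ℕ} (k : Bits (n + n)) : Bits n := fun i => k (Fin.natAdd n i)

/-- Kraus operators of key generation: a uniformly random basis state of the key register. -/
noncomputable def keyKraus (n : ℕ) (k : Bits (n + n)) : Matrix (Bits (n + n)) (Bits 0) ℂ :=
  (1 / (Real.sqrt (2 ^ (n + n)) : ℂ)) • outer (ket k) (ket default)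

/-- Kraus operators of encryption: measure the key `(r, θ)` and the message `m` in the
computational basis, and output `|(m ⊕ r)^θ⟩`. -/
noncomputable def encKraus (n : ℕ) (p : Bits (n + n) × Bits n) :
    Matrix (Bits n) (Bits (n + n) × Bits n) ℂ :=
  outer (wiesner (bxor p.2 (keyR p.1)) (keyθ p.1)) (ket p)

/-- Kraus operators of decryption: measure the key `(r, θ)`, apply `H^θ` to the ciphertext,
measure it in the computational basis with result `c`, and output `|c ⊕ r⟩`. -/
noncomputable def decKraus (n : ℕ) (p : Bits (n + n) × Bits n) :
    Matrix (Bits n) (Bits (n + n) × Bits n) ℂ :=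
  outer (ket (bxor p.2 (keyR p.1))) (ket p) * ((1 : Op (Bits (n + n))) ⊗ₖ hadamardPow (keyθ p.1))

theorem ket_apply {a : Type} [DecidableEq a] (s t : a) : ket s t = if t = s then 1 else 0 := by
  simp [ket, Pi.single_apply]

theorem outer_mul_outer {a b c : Type} [Fintype b] (u : a → ℂ) (v w : b → ℂ) (z : c → ℂ) :
    outer u v * outer w z = (star v ⬝ᵥ w) • outer u z := by
  ext i j
  simp [outer, Matrix.mul_apply, Matrix.vecMulVec_apply, dotProduct, Finset.sum_mul, mul_assoc]
  refine Finset.sum_congr rfl fun x _ => by ring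

theorem conjTranspose_outer {a b : Type} (u : a → ℂ) (v : b → ℂ) :
    (outer u v).conjTranspose = outer v u := by
  ext i j
  simp [outer, Matrix.vecMulVec_apply, mul_comm]

theorem star_ket_dotProduct_ket {a : Type} [Fintype a] [DecidableEq a] (s t : a) :
    star (ket s) ⬝ᵥ ket t = if s = t then 1 else 0 := by
  simp [dotProduct, ket_apply, apply_ite, eq_comm]

theorem ketbra_ket_prod {a b : Type} [DecidableEq a] [DecidableEq b] (p : a × b) :
    ketbra (ket p) = ketbra (ket p.1) ⊗ₖ ketbra (ket p.2) := by
  ext i j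
  simp only [ketbra, outer, Matrix.vecMulVec_apply, Pi.star_apply, ket_apply,
    Matrix.kroneckerMap_apply, Prod.ext_iff, ite_and, apply_ite star, star_one, star_zero]
  split_ifs <;> simp

theorem sum_ketbra_ket {a : Type} [Fintype a] [DecidableEq a] :
    ∑ s : a, ketbra (ket s) = 1 := by
  ext i j
  simp only [Matrix.sum_apply, ketbra, outer, Matrix.vecMulVec_apply, Pi.star_apply, ket_apply,
    Matrix.one_apply]
  simp [apply_ite]

theorem outer_mul_mul_outer {a b c d : Type} [Fintype b] [DecidableEq b] [Fintype c]
    [DecidableEq c] (u : a → ℂ) (s : b) (M : Matrix b c ℂ) (t : c) (v : d → ℂ) :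
    outer u (ket s) * M * outer (ket t) v = M s t • outer u v := by
  have h : M * outer (ket t) v = outer (fun i => M i t) v := by
    ext i j
    simp [outer, Matrix.mul_apply, Matrix.vecMulVec_apply, ket_apply]
  rw [Matrix.mul_assoc, h, outer_mul_outer]
  congr 1
  simp [dotProduct, ket_apply, apply_ite]

theorem hadamard_mul_self (θ : Bool) : hadamard θ * hadamard θ = 1 := by
  have h : ((Real.sqrt 2 : ℝ) : ℂ) * ((Real.sqrt 2 : ℝ) : ℂ) = 2 := by
    rw [← Complex.ofReal_mul, Real.mul_self_sqrt (by norm_num)]; norm_num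
  have h0 : ((Real.sqrt 2 : ℝ) : ℂ) ≠ 0 := by
    intro h1; rw [h1] at h; norm_num at h
  ext i j
  cases θ <;> cases i <;> cases j <;>
    simp [hadamard, Matrix.mul_apply] <;> field_simp <;>
    (try rw [pow_two, h]) <;> norm_num

theorem hadamardPow_mul_self {n : ℕ} (θ : Bits n) : hadamardPow θ * hadamardPow θ = 1 := by
  ext y x
  simp only [Matrix.mul_apply, hadamardPow, Matrix.of_apply, ← Finset.prod_mul_distrib]
  rw [← Fintype.prod_sum (fun i z => hadamard (θ i) (y i) z * hadamard (θ i) z (x i))]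
  have h : ∀ i, ∑ z, hadamard (θ i) (y i) z * hadamard (θ i) z (x i)
      = if y i = x i then 1 else 0 := fun i => by
    rw [← Matrix.mul_apply, hadamard_mul_self, Matrix.one_apply]
  simp only [h, Matrix.one_apply]
  by_cases hyx : y = x
  · simp [hyx]
  · obtain ⟨i, hi⟩ := Function.ne_iff.mp hyx
    rw [if_neg hyx]
    exact Finset.prod_eq_zero (Finset.mem_univ i) (if_neg hi)

theorem conjTranspose_hadamardPow {n : ℕ} (θ : Bits n) :
    (hadamardPow θ).conjTranspose = hadamardPow θ := by
  ext y x
  simp only [Matrix.conjTranspose_apply, hadamardPow, Matrix.of_apply, star_prod]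
  refine Finset.prod_congr rfl fun i _ => ?_
  cases θ i <;> cases x i <;> cases y i <;> simp [hadamard]

theorem star_wiesner_dotProduct_wiesner {n : ℕ} (x y θ : Bits n) :
    star (wiesner x θ) ⬝ᵥ wiesner y θ = if x = y then 1 else 0 := by
  rw [wiesner, wiesner, Matrix.star_mulVec, conjTranspose_hadamardPow, Matrix.dotProduct_mulVec,
    Matrix.vecMul_vecMul, hadamardPow_mul_self, Matrix.vecMul_one, star_ket_dotProduct_ket]

theorem sum_keyKraus (n : ℕ) : ∑ k, (keyKraus n k).conjTranspose * keyKraus n k = 1 := by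
  have hc : (starRingEnd ℂ) (1 / (Real.sqrt (2 ^ (n + n)) : ℂ)) * (1 / (Real.sqrt (2 ^ (n + n)) : ℂ))
      = 1 / (2 : ℂ) ^ (n + n) := by
    rw [map_div₀, map_one, Complex.conj_ofReal, div_mul_div_comm, ← Complex.ofReal_mul,
      Real.mul_self_sqrt (by positivity)]
    norm_num
  have h : ∀ k, (keyKraus n k).conjTranspose * keyKraus n k = (1 / (2 : ℂ) ^ (n + n)) • 1 := by
    intro k
    rw [keyKraus, Matrix.conjTranspose_smul, Matrix.smul_mul, Matrix.mul_smul, smul_smul,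
      conjTranspose_outer, outer_mul_outer, star_ket_dotProduct_ket, if_pos rfl, one_smul]
    have h1 : outer (ket (default : Bits 0)) (ket (default : Bits 0)) = 1 := by
      ext i j
      simp [outer, Matrix.vecMulVec_apply, ket_apply, Matrix.one_apply,
        Subsingleton.elim i default, Subsingleton.elim j default]
    rw [h1]
    exact congrArg (fun z : ℂ => z • (1 : Op (Bits 0))) hc
  simp only [h, Finset.sum_const, Finset.card_univ, Fintype.card_fun, Fintype.card_bool,
    Fintype.card_fin, ← Nat.cast_smul_eq_nsmul ℂ, smul_smul]
  rw [Nat.cast_pow, Nat.cast_ofNat, mul_one_div_cancel (by positivity), one_smul]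

theorem sum_encKraus (n : ℕ) : ∑ p, (encKraus n p).conjTranspose * encKraus n p = 1 := by
  rw [← sum_ketbra_ket]
  refine Finset.sum_congr rfl fun p _ => ?_
  rw [encKraus, conjTranspose_outer, outer_mul_outer, star_wiesner_dotProduct_wiesner, if_pos rfl,
    one_smul]
  rfl

theorem sum_decKraus (n : ℕ) : ∑ p, (decKraus n p).conjTranspose * decKraus n p = 1 := by
  have h : ∀ p : Bits (n + n) × Bits n, (decKraus n p).conjTranspose * decKraus n p =
      ketbra (ket p.1) ⊗ₖ
        (hadamardPow (keyθ p.1) * ketbra (ket p.2) * hadamardPow (keyθ p.1)) := by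
    intro p
    have h1 : outer (ket p) (ket p) = ketbra (ket p.1) ⊗ₖ ketbra (ket p.2) := by
      rw [← ketbra, ketbra_ket_prod]
    rw [decKraus, Matrix.conjTranspose_mul, conjTranspose_outer, Matrix.mul_assoc,
      ← Matrix.mul_assoc (outer (ket p) _), outer_mul_outer, star_ket_dotProduct_ket, if_pos rfl,
      one_smul, h1, Matrix.conjTranspose_kronecker, Matrix.conjTranspose_one,
      conjTranspose_hadamardPow, ← Matrix.mul_kronecker_mul, ← Matrix.mul_kronecker_mul,
      Matrix.one_mul, Matrix.mul_one, Matrix.mul_assoc]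
  simp only [h, Fintype.sum_prod_type]
  have h2 : ∀ k : Bits (n + n), ∑ c : Bits n, ketbra (ket k) ⊗ₖ
      (hadamardPow (keyθ k) * ketbra (ket c) * hadamardPow (keyθ k)) = ketbra (ket k) ⊗ₖ 1 := by
    intro k
    have h3 : ∑ c : Bits n, hadamardPow (keyθ k) * ketbra (ket c) * hadamardPow (keyθ k) = 1 := by
      rw [← Finset.sum_mul, ← Finset.mul_sum, sum_ketbra_ket, Matrix.mul_one,
        hadamardPow_mul_self]
    rw [← h3]
    ext i j
    simp only [Matrix.sum_apply, Matrix.kroneckerMap_apply, Finset.mul_sum]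
  simp only [h2]
  rw [← Matrix.one_kronecker_one, ← sum_ketbra_ket (a := Bits (n + n))]
  ext i j
  simp only [Matrix.sum_apply, Matrix.kroneckerMap_apply, Finset.sum_mul]

/-- Key generation outputs the uniform mixture of all keys. -/
noncomputable def conjKey (n : ℕ) : CPTP (Bits 0) (Bits (n + n)) :=
  CPTP.ofKraus (keyKraus n) (sum_keyKraus n)

/-- The encryption channel. -/
noncomputable def conjEnc (n : ℕ) : CPTP (Bits (n + n) × Bits n) (Bits n) :=
  CPTP.ofKraus (encKraus n) (sum_encKraus n)

/-- The decryption channel. -/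
noncomputable def conjDec (n : ℕ) : CPTP (Bits (n + n) × Bits n) (Bits n) :=
  CPTP.ofKraus (decKraus n) (sum_decKraus n)

/-- The key distribution is uniform. -/
theorem conjKey_map_one (n : ℕ) :
    (conjKey n).map 1 = (1 / (2 : ℂ) ^ (n + n)) • ∑ k, ketbra (ket k) := by
  change krausMap (keyKraus n) 1 = _
  rw [krausMap_apply, Finset.smul_sum]
  refine Finset.sum_congr rfl fun k _ => ?_
  have hc : (1 / (Real.sqrt (2 ^ (n + n)) : ℂ)) * (starRingEnd ℂ) (1 / (Real.sqrt (2 ^ (n + n)) : ℂ))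
      = 1 / (2 : ℂ) ^ (n + n) := by
    rw [map_div₀, map_one, Complex.conj_ofReal, div_mul_div_comm, ← Complex.ofReal_mul,
      Real.mul_self_sqrt (by positivity)]
    norm_num
  rw [Matrix.mul_one, keyKraus, Matrix.conjTranspose_smul, Matrix.smul_mul, Matrix.mul_smul,
    smul_smul, conjTranspose_outer, outer_mul_outer, star_ket_dotProduct_ket, if_pos rfl, one_smul]
  exact congrArg (fun z : ℂ => z • ketbra (ket k)) hc

/-- The message `m` is encrypted under the key `(r, θ)` as the state `|(m ⊕ r)^θ⟩`. -/
theorem conjEnc_keyed (n : ℕ) (k : Bits (n + n)) (m : Bits n) :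
    (conjEnc n).keyed k (ketbra (ket m)) = ketbra (wiesner (bxor m (keyR k)) (keyθ k)) := by
  change krausMap (encKraus n) (ketbra (ket k) ⊗ₖ ketbra (ket m)) = _
  rw [← ketbra_ket_prod (k, m), krausMap_apply, Finset.sum_eq_single (k, m)]
  · rw [encKraus, conjTranspose_outer, ketbra, outer_mul_outer, star_ket_dotProduct_ket,
      if_pos rfl, one_smul, outer_mul_outer, star_ket_dotProduct_ket, if_pos rfl, one_smul, ketbra]
  · intro p _ hp
    rw [encKraus, ketbra, outer_mul_outer, star_ket_dotProduct_ket, if_neg hp, zero_smul,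
      Matrix.zero_mul]
  · simp

/-- Under the key `(r, θ)`, decryption applies `H^θ`, measures in the computational basis, and
outputs the exclusive or of the result with `r`. -/
theorem conjDec_keyed (n : ℕ) (k : Bits (n + n)) (ρ : Op (Bits n)) :
    (conjDec n).keyed k ρ = ∑ c, (hadamardPow (keyθ k) * ρ * hadamardPow (keyθ k)) c c •
      ketbra (ket (bxor c (keyR k))) := by
  change krausMap (decKraus n) (ketbra (ket k) ⊗ₖ ρ) = _
  have h : ∀ p : Bits (n + n) × Bits n,
      decKraus n p * (ketbra (ket k) ⊗ₖ ρ) * (decKraus n p).conjTranspose =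
      (if p.1 = k then (hadamardPow (keyθ p.1) * ρ * hadamardPow (keyθ p.1)) p.2 p.2 else 0) •
        ketbra (ket (bxor p.2 (keyR p.1))) := by
    intro p
    have h1 : decKraus n p * (ketbra (ket k) ⊗ₖ ρ) * (decKraus n p).conjTranspose =
        outer (ket (bxor p.2 (keyR p.1))) (ket p) *
          (ketbra (ket k) ⊗ₖ (hadamardPow (keyθ p.1) * ρ * hadamardPow (keyθ p.1))) *
          outer (ket p) (ket (bxor p.2 (keyR p.1))) := by
      rw [decKraus, Matrix.conjTranspose_mul, conjTranspose_outer, Matrix.conjTranspose_kronecker,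
        Matrix.conjTranspose_one, conjTranspose_hadamardPow]
      have h2 : ketbra (ket k) ⊗ₖ (hadamardPow (keyθ p.1) * ρ * hadamardPow (keyθ p.1)) =
          ((1 : Op (Bits (n + n))) ⊗ₖ hadamardPow (keyθ p.1)) * (ketbra (ket k) ⊗ₖ ρ) *
            ((1 : Op (Bits (n + n))) ⊗ₖ hadamardPow (keyθ p.1)) := by
        rw [← Matrix.mul_kronecker_mul, ← Matrix.mul_kronecker_mul, Matrix.one_mul, Matrix.mul_one]
      rw [h2]
      simp only [Matrix.mul_assoc]
    rw [h1, outer_mul_mul_outer, ← ketbra]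
    congr 1
    by_cases hp : p.1 = k <;>
      simp [Matrix.kroneckerMap_apply, ketbra, outer, Matrix.vecMulVec_apply, ket_apply, hp]
  rw [krausMap_apply]
  simp only [h]
  rw [Fintype.sum_prod_type, Finset.sum_eq_single k]
  · simp
  · intro k' _ hk'
    simp [hk']
  · simp

theorem conj_correct (n : ℕ) (k : Bits (n + n)) (m : Bits n) :
    (ketbra (ket m) *
      (conjDec n).keyed k ((conjEnc n).keyed k (ketbra (ket m)))).trace = 1 := by
  set r := keyR k
  set θ := keyθ k
  have hx : bxor (bxor m r) r = m := by
    funext i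
    simp [bxor]
  have h1 : hadamardPow θ * ketbra (wiesner (bxor m r) θ) * hadamardPow θ =
      ketbra (ket (bxor m r)) := by
    have h2 : ketbra (wiesner (bxor m r) θ) =
        hadamardPow θ * ketbra (ket (bxor m r)) * hadamardPow θ := by
      conv_rhs => rw [← conjTranspose_hadamardPow θ]
      rw [conjTranspose_hadamardPow, ketbra, ketbra, outer, outer, Matrix.mul_vecMulVec,
        Matrix.vecMulVec_mul, wiesner, Matrix.star_mulVec, conjTranspose_hadamardPow]
    rw [h2, Matrix.mul_assoc, Matrix.mul_assoc, Matrix.mul_assoc, hadamardPow_mul_self,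
      Matrix.mul_one, ← Matrix.mul_assoc, hadamardPow_mul_self, Matrix.one_mul]
  rw [conjEnc_keyed, conjDec_keyed, h1, Finset.sum_eq_single (bxor m r)]
  · rw [hx]
    simp only [ketbra]
    rw [Matrix.mul_smul, outer_mul_outer, star_ket_dotProduct_ket, if_pos rfl, one_smul]
    simp [outer, Matrix.trace, Matrix.vecMulVec_apply, ket_apply, apply_ite]
  · intro c _ hc
    simp [ketbra, outer, Matrix.vecMulVec_apply, ket_apply, hc]
  · simp

/-- The conjugate encryption scheme: message size `λ`, key size `2λ`, ciphertext size `λ`. -/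
noncomputable def conjugateEncryption : QECM where
  n lam := lam
  κ lam := lam + lam
  ℓ lam := lam
  Key lam := conjKey lam
  Enc lam := conjEnc lam
  Dec lam := conjDec lam
  correct lam k m _ := conj_correct lam k m

end QuantumEnc

namespace QuantumEnc

/-! ### Squared norms of vectors -/

/-! For each fixed `r` the cloning game is, after relabelling messages as `x = m ⊕ r`, a
monogamy-of-entanglement game: the state `|x^θ⟩` is split by `A`, and both parties, told `θ`, must
guess `x`. By Choi's theorem (`CPTP.exists_kraus`) all channels have Kraus operators. Those of `B`
and `C` yield measurements `F θ x`, `G θ x` with `∑ x, F†F = ∑ x, G†G = 1`, and the unnormalised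
value is the sum of `‖(F θ x ⊗ G θ x) K |x^θ⟩‖²` over `θ`, `x` and the Kraus operators `K` of `A`.

The core is `monogamy_bound`. Writing `φ` for these vectors, `S` for the total of their squared
norms for one `K`, and `w = (F ⊗ G)† φ`, form the operator `Z = ∑ |w⟩⟨x^θ|`. Then `⟨Z, K⟩ = S` in
the Hilbert–Schmidt inner product, while `‖Z‖²` expands into overlaps of Wiesner states times `⟨w,
w'⟩`. If the overlaps between bases `θ` and `θ'` are at most `g θ θ'`, with `g` symmetric and all
row sums equal to `c`, then `‖Z‖² ≤ c S`, and Cauchy–Schwarz gives `S ≤ c ‖K‖²`. The double sum over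
outcomes costs no dimension factor: by `norm_sum_kronecker_overlap_le`, one party's measurement
absorbs the sum over `x` and the other's the sum over `y`.

For Wiesner states each position where the bases differ contributes `1/√2`, so `c = (1 + 1/√2)^n`
(`sum_basisOverlap`). The squared Frobenius norms of the `K` add up to `2^n` (`sum_frobSq`).
Averaging over `m`, `r` and `θ` leaves `((1 + 1/√2)/2)^n`. -/

/-- The squared Euclidean norm of a complex vector. -/
noncomputable def normSqVec {a : Type} [Fintype a] (v : a → ℂ) : ℝ := ∑ i, ‖v i‖ ^ 2

theorem normSqVec_nonneg {a : Type} [Fintype a] (v : a → ℂ) : 0 ≤ normSqVec v :=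
  Finset.sum_nonneg fun _ _ => by positivity

theorem star_dotProduct_self {a : Type} [Fintype a] (v : a → ℂ) :
    star v ⬝ᵥ v = (normSqVec v : ℂ) := by
  simp [dotProduct, normSqVec, Complex.conj_mul']

/-- Cauchy–Schwarz in its arithmetic-mean form: being linear in the squared norms, it can be summed
over families without square roots. -/
theorem norm_star_dotProduct_le {a : Type} [Fintype a] (u v : a → ℂ) :
    ‖star u ⬝ᵥ v‖ ≤ (normSqVec u + normSqVec v) / 2 := by
  refine (norm_sum_le _ _).trans ?_
  rw [normSqVec, normSqVec, ← Finset.sum_add_distrib, Finset.sum_div]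
  refine Finset.sum_le_sum fun i _ => ?_
  rw [norm_mul, Pi.star_apply, norm_star]
  nlinarith [sq_nonneg (‖u i‖ - ‖v i‖)]

theorem star_mulVec_dotProduct {a b : Type} [Fintype a] [Fintype b] (M : Matrix a b ℂ)
    (u : b → ℂ) (v : a → ℂ) :
    star (M.mulVec u) ⬝ᵥ v = star u ⬝ᵥ M.conjTranspose.mulVec v := by
  rw [Matrix.star_mulVec, Matrix.dotProduct_mulVec]

theorem sum_normSqVec_mulVec {X a b : Type} [Fintype X] [Fintype a] [Fintype b] [DecidableEq b]
    (T : X → Matrix a b ℂ) (hT : ∑ x, (T x).conjTranspose * T x = 1) (u : b → ℂ) :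
    ∑ x, normSqVec ((T x).mulVec u) = normSqVec u := by
  have h : ((∑ x, normSqVec ((T x).mulVec u) : ℝ) : ℂ) = (normSqVec u : ℂ) := by
    rw [Complex.ofReal_sum, ← star_dotProduct_self]
    calc ∑ x, ((normSqVec ((T x).mulVec u) : ℝ) : ℂ)
        = ∑ x, star u ⬝ᵥ ((T x).conjTranspose * T x).mulVec u := by
          refine Finset.sum_congr rfl fun x _ => ?_
          rw [← star_dotProduct_self, star_mulVec_dotProduct, Matrix.mulVec_mulVec]
      _ = star u ⬝ᵥ u := by
          rw [← dotProduct_sum, ← Matrix.sum_mulVec, hT, Matrix.one_mulVec]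
  exact_mod_cast h

/-- Each `T x` is a contraction, hence so is its adjoint: with `w = (T x)† u`, one has `‖w‖² = |⟨T x
w, u⟩| ≤ (‖w‖² + ‖u‖²) / 2`. -/
theorem normSqVec_conjTranspose_mulVec_le {X a b : Type} [Fintype X] [Fintype a] [Fintype b]
    [DecidableEq b] (T : X → Matrix a b ℂ) (hT : ∑ x, (T x).conjTranspose * T x = 1) (x : X)
    (u : a → ℂ) : normSqVec ((T x).conjTranspose.mulVec u) ≤ normSqVec u := by
  set w := (T x).conjTranspose.mulVec u
  have h1 : normSqVec ((T x).mulVec w) ≤ normSqVec w := by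
    rw [← sum_normSqVec_mulVec T hT w]
    exact Finset.single_le_sum (f := fun x => normSqVec ((T x).mulVec w))
      (fun _ _ => normSqVec_nonneg _) (Finset.mem_univ x)
  have h2 : normSqVec w = ‖star ((T x).mulVec w) ⬝ᵥ u‖ := by
    rw [star_mulVec_dotProduct, star_dotProduct_self, Complex.norm_real,
      Real.norm_of_nonneg (normSqVec_nonneg w)]
  have h3 := norm_star_dotProduct_le ((T x).mulVec w) u
  linarith

/-! ### The operator-norm bound for monogamy games -/

theorem sum_one_kronecker {X a b i : Type} [Fintype X] [Fintype a] [Fintype b] [DecidableEq b]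
    [Fintype i] [DecidableEq i] (T : X → Matrix a b ℂ)
    (hT : ∑ x, (T x).conjTranspose * T x = 1) :
    ∑ x, ((1 : Op i) ⊗ₖ T x).conjTranspose * ((1 : Op i) ⊗ₖ T x) = 1 := by
  simp only [Matrix.conjTranspose_kronecker, ← Matrix.mul_kronecker_mul,
    Matrix.conjTranspose_one, Matrix.mul_one]
  rw [← Matrix.one_kronecker_one, ← hT]
  ext p q
  simp only [Matrix.sum_apply, Matrix.kroneckerMap_apply, Finset.mul_sum]

theorem sum_kronecker_one {X a b i : Type} [Fintype X] [Fintype a] [Fintype b] [DecidableEq b]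
    [Fintype i] [DecidableEq i] (T : X → Matrix a b ℂ)
    (hT : ∑ x, (T x).conjTranspose * T x = 1) :
    ∑ x, (T x ⊗ₖ (1 : Op i)).conjTranspose * (T x ⊗ₖ (1 : Op i)) = 1 := by
  simp only [Matrix.conjTranspose_kronecker, ← Matrix.mul_kronecker_mul,
    Matrix.conjTranspose_one, Matrix.mul_one]
  rw [← Matrix.one_kronecker_one, ← hT]
  ext p q
  simp only [Matrix.sum_apply, Matrix.kroneckerMap_apply, Finset.sum_mul]

/-- The overlap of two product measurements, with coefficients bounded by `g`. -/
theorem norm_sum_kronecker_overlap_le {X B C I J : Type} [Fintype X] [Fintype B] [DecidableEq B]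
    [Fintype C] [DecidableEq C] [Fintype I] [DecidableEq I] [Fintype J] [DecidableEq J]
    (F F' : X → Matrix I B ℂ) (G G' : X → Matrix J C ℂ)
    (hF : ∑ x, (F x).conjTranspose * F x = 1) (hF' : ∑ x, (F' x).conjTranspose * F' x = 1)
    (hG : ∑ x, (G x).conjTranspose * G x = 1) (hG' : ∑ x, (G' x).conjTranspose * G' x = 1)
    (M : X → X → ℂ) (g : ℝ) (hM : ∀ x y, ‖M x y‖ ≤ g) (hg : 0 ≤ g) (φ φ' : X → I × J → ℂ) :
    ‖∑ x, ∑ y, M x y * (star ((F x ⊗ₖ G x).conjTranspose.mulVec (φ x)) ⬝ᵥ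
      (F' y ⊗ₖ G' y).conjTranspose.mulVec (φ' y))‖ ≤
      g * ((∑ x, normSqVec (φ x) + ∑ x, normSqVec (φ' x)) / 2) := by
  -- The operator `F x F'(y)† ⊗ G x G'(y)†` is a product of commuting factors on the two sides.
  -- Moving the `G` factor to the left vector lets the sum over `y` be taken by `G'` in `u`, and the
  -- sum over `x` by `F` in `v`.
  let u : X → X → I × J → ℂ := fun x y => ((1 : Op I) ⊗ₖ G' y).mulVec
    (((1 : Op I) ⊗ₖ G x).conjTranspose.mulVec (φ x))
  let v : X → X → I × J → ℂ := fun x y => (F x ⊗ₖ (1 : Op J)).mulVec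
    ((F' y ⊗ₖ (1 : Op J)).conjTranspose.mulVec (φ' y))
  have huv : ∀ x y, star ((F x ⊗ₖ G x).conjTranspose.mulVec (φ x)) ⬝ᵥ
      (F' y ⊗ₖ G' y).conjTranspose.mulVec (φ' y) = star (u x y) ⬝ᵥ v x y := by
    intro x y
    simp only [u, v, star_mulVec_dotProduct, Matrix.mulVec_mulVec, Matrix.conjTranspose_kronecker,
      Matrix.conjTranspose_conjTranspose, Matrix.conjTranspose_one, ← Matrix.mul_kronecker_mul,
      Matrix.one_mul, Matrix.mul_one, Matrix.conjTranspose_mul]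
  have hu : ∑ x, ∑ y, normSqVec (u x y) ≤ ∑ x, normSqVec (φ x) :=
    Finset.sum_le_sum fun x _ => by
      rw [sum_normSqVec_mulVec _ (sum_one_kronecker G' hG')]
      exact normSqVec_conjTranspose_mulVec_le _ (sum_one_kronecker G hG) x _
  have hv : ∑ x, ∑ y, normSqVec (v x y) ≤ ∑ x, normSqVec (φ' x) := by
    rw [Finset.sum_comm]
    refine Finset.sum_le_sum fun y _ => ?_
    rw [sum_normSqVec_mulVec _ (sum_kronecker_one F hF)]
    exact normSqVec_conjTranspose_mulVec_le _ (sum_kronecker_one F' hF') y _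
  calc _ ≤ ∑ x, ∑ y, g * ((normSqVec (u x y) + normSqVec (v x y)) / 2) := by
        refine norm_sum_le_of_le _ fun x _ => norm_sum_le_of_le _ fun y _ => ?_
        rw [norm_mul, huv]
        exact mul_le_mul (hM x y) (norm_star_dotProduct_le _ _) (norm_nonneg _) hg
    _ = g * ((∑ x, ∑ y, normSqVec (u x y) + ∑ x, ∑ y, normSqVec (v x y)) / 2) := by
        simp only [← Finset.mul_sum, ← Finset.sum_div, ← Finset.sum_add_distrib]
    _ ≤ _ := by gcongr

/-- The squared Frobenius norm of a matrix. -/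
noncomputable def frobSq {a b : Type} [Fintype a] [Fintype b] (K : Matrix a b ℂ) : ℝ :=
  normSqVec fun p : a × b => K p.1 p.2

/-- The bound on the value of a monogamy-of-entanglement game with a Gram matrix of overlaps
whose row sums are at most `c`. -/
theorem monogamy_bound {Θ X E B C I J : Type} [Fintype Θ] [Fintype X] [Fintype E] [Fintype B]
    [DecidableEq B] [Fintype C] [DecidableEq C] [Fintype I] [DecidableEq I] [Fintype J]
    [DecidableEq J] (p : Θ → X → E → ℂ) (F : Θ → X → Matrix I B ℂ) (G : Θ → X → Matrix J C ℂ)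
    (hF : ∀ θ, ∑ x, (F θ x).conjTranspose * F θ x = 1)
    (hG : ∀ θ, ∑ x, (G θ x).conjTranspose * G θ x = 1)
    (g : Θ → Θ → ℝ) (hp : ∀ θ θ' x y, ‖star (p θ' y) ⬝ᵥ p θ x‖ ≤ g θ θ')
    (hg0 : ∀ θ θ', 0 ≤ g θ θ') (hgs : ∀ θ θ', g θ θ' = g θ' θ) (c : ℝ) (hc0 : 0 < c)
    (hc : ∀ θ, ∑ θ', g θ θ' = c) (K : Matrix (B × C) E ℂ) :
    ∑ θ, ∑ x, normSqVec ((F θ x ⊗ₖ G θ x).mulVec (K.mulVec (p θ x))) ≤ c * frobSq K := by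
  set φ : Θ → X → I × J → ℂ := fun θ x => (F θ x ⊗ₖ G θ x).mulVec (K.mulVec (p θ x))
  set w : Θ → X → B × C → ℂ := fun θ x => (F θ x ⊗ₖ G θ x).conjTranspose.mulVec (φ θ x)
  -- The operator `∑ |w⟩⟨p|`, flattened to a vector so that its inner product with `K` is the
  -- Hilbert–Schmidt one.
  let Z : (B × C) × E → ℂ := fun q => ∑ θ, ∑ x, w θ x q.1 * star (p θ x q.2)
  set S : ℝ := ∑ θ, ∑ x, normSqVec (φ θ x) with hS
  have hS0 : 0 ≤ S := Finset.sum_nonneg fun _ _ => Finset.sum_nonneg fun _ _ => normSqVec_nonneg _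
  have hZK : star Z ⬝ᵥ (fun q : (B × C) × E => K q.1 q.2) = (S : ℂ) := by
    have h1 : ∀ θ x, ((normSqVec (φ θ x) : ℝ) : ℂ) = star (w θ x) ⬝ᵥ K.mulVec (p θ x) := by
      intro θ x
      rw [← star_dotProduct_self]
      exact ((star_mulVec_dotProduct _ _ _).trans
        (by rw [Matrix.conjTranspose_conjTranspose])).symm
    simp only [hS, Complex.ofReal_sum, h1]
    simp only [dotProduct, Matrix.mulVec, Pi.star_apply, Z, star_sum, star_mul', star_star,
      Finset.sum_mul, Finset.mul_sum, Fintype.sum_prod_type (α₁ := B × C)]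
    rw [Finset.sum_congr rfl fun _ _ => Finset.sum_comm, Finset.sum_comm]
    refine Finset.sum_congr rfl fun θ _ => ?_
    rw [Finset.sum_congr rfl fun _ _ => Finset.sum_comm, Finset.sum_comm]
    refine Finset.sum_congr rfl fun x _ => Finset.sum_congr rfl fun i _ =>
      Finset.sum_congr rfl fun e _ => by ring
  have hZZ : star Z ⬝ᵥ Z = ∑ θ, ∑ θ', ∑ x, ∑ y,
      (star (p θ' y) ⬝ᵥ p θ x) * (star (w θ x) ⬝ᵥ w θ' y) := by
    have h1 : ∀ q, star Z q * Z q = ∑ θ, ∑ θ', ∑ x, ∑ y,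
        (star (p θ' y q.2) * p θ x q.2) * (star (w θ x q.1) * w θ' y q.1) := by
      intro q
      simp only [Z, Pi.star_apply, star_sum, star_mul', star_star]
      rw [Finset.sum_mul_sum]
      refine Finset.sum_congr rfl fun θ _ => Finset.sum_congr rfl fun θ' _ => ?_
      rw [Finset.sum_mul_sum]
      refine Finset.sum_congr rfl fun x _ => Finset.sum_congr rfl fun y _ => by ring
    simp only [dotProduct, h1]
    rw [Finset.sum_comm]
    refine Finset.sum_congr rfl fun θ _ => ?_
    rw [Finset.sum_comm]
    refine Finset.sum_congr rfl fun θ' _ => ?_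
    rw [Finset.sum_comm]
    refine Finset.sum_congr rfl fun x _ => ?_
    rw [Finset.sum_comm]
    refine Finset.sum_congr rfl fun y _ => ?_
    rw [Finset.sum_mul_sum, Fintype.sum_prod_type, Finset.sum_comm]
    rfl
  have hZ : normSqVec Z ≤ c * S := by
    have h1 : normSqVec Z = ‖star Z ⬝ᵥ Z‖ := by
      rw [star_dotProduct_self, Complex.norm_real, Real.norm_of_nonneg (normSqVec_nonneg Z)]
    rw [h1, hZZ]
    set s : Θ → ℝ := fun θ => ∑ x, normSqVec (φ θ x)
    calc _ ≤ ∑ θ, ∑ θ', g θ θ' * ((s θ + s θ') / 2) :=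
          norm_sum_le_of_le _ fun θ _ => norm_sum_le_of_le _ fun θ' _ =>
            norm_sum_kronecker_overlap_le (F θ) (F θ') (G θ) (G θ') (hF θ) (hF θ') (hG θ) (hG θ')
              _ _ (hp θ θ') (hg0 θ θ') (φ θ) (φ θ')
      -- Symmetry of `g` turns both halves into row sums, each equal to `c * S / 2`.
      _ = (∑ θ, ∑ θ', g θ θ' * s θ) / 2 + (∑ θ, ∑ θ', g θ' θ * s θ') / 2 := by
          simp only [Finset.sum_div, ← Finset.sum_add_distrib]
          refine Finset.sum_congr rfl fun θ _ => Finset.sum_congr rfl fun θ' _ => ?_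
          rw [hgs θ' θ]; ring
      _ = c * S := by
          rw [Finset.sum_comm (f := fun θ θ' => g θ' θ * s θ')]
          simp only [← Finset.sum_mul, hc, ← Finset.mul_sum]
          ring
  have hscale : normSqVec (fun i => (c : ℂ) * K i.1 i.2 : (B × C) × E → ℂ) = c ^ 2 * frobSq K := by
    simp only [normSqVec, frobSq, norm_mul, mul_pow, ← Finset.mul_sum, Complex.norm_real,
      Real.norm_of_nonneg hc0.le]
  -- Scaling `K` by `c` balances the arithmetic-mean bound: `c S ≤ (c S + c² ‖K‖²) / 2`, so nothing
  -- is lost against true Cauchy–Schwarz.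
  have h1 : c * S = ‖star Z ⬝ᵥ (fun i => (c : ℂ) * K i.1 i.2 : (B × C) × E → ℂ)‖ := by
    have : (fun i => (c : ℂ) * K i.1 i.2 : (B × C) × E → ℂ) =
        (c : ℂ) • (fun q : (B × C) × E => K q.1 q.2) := rfl
    rw [this, dotProduct_smul, hZK, smul_eq_mul, ← Complex.ofReal_mul, Complex.norm_real,
      Real.norm_of_nonneg (mul_nonneg hc0.le hS0)]
  have h2 := norm_star_dotProduct_le Z (fun i => (c : ℂ) * K i.1 i.2)
  rw [hscale] at h2
  have h3 : c * S ≤ c * (c * frobSq K) := by nlinarith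
  exact le_of_mul_le_mul_left h3 hc0

/-! ### Kraus decompositions -/

/-- Choi's argument: the image of the unnormalised maximally entangled state is positive
semidefinite, and the vectors of a rank-one decomposition reshape into Kraus operators. -/
theorem CPTP.exists_kraus {a b : Type} [Fintype a] [DecidableEq a] [Fintype b] [DecidableEq b]
    (Φ : CPTP a b) :
    ∃ (N : ℕ) (K : Fin N → Matrix b a ℂ),
      Φ.map = krausMap K ∧ ∑ i, (K i).conjTranspose * K i = 1 := by
  -- Complete positivity is quantified over ancillas `Fin k`, so the reference copy of `a` must be
  -- enumerated.
  let e : a ≃ Fin (Fintype.card a) := Fintype.equivFin a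
  let v : Fin (Fintype.card a) × a → ℂ := fun p => if p.1 = e p.2 then 1 else 0
  have hJ := Φ.completely_positive _ (Matrix.vecMulVec v (star v))
    (Matrix.posSemidef_vecMulVec_self_star v)
  obtain ⟨N, L, hL⟩ := Matrix.posSemidef_iff_eq_sum_vecMulVec.mp hJ
  have hvv : ∀ p q : a, (Matrix.of fun x y => Matrix.vecMulVec v (star v) (e p, x) (e q, y)) =
      Matrix.single p q (1 : ℂ) := by
    intro p q
    ext x y
    simp only [Matrix.of_apply, Matrix.vecMulVec_apply, Pi.star_apply, v, Matrix.single_apply,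
      EmbeddingLike.apply_eq_iff_eq, ite_and]
    split_ifs <;> simp
  have hΦ : ∀ (p q : a) (i j : b), Φ.map (Matrix.single p q 1) i j =
      ∑ l, L l (e p, i) * star (L l (e q, j)) := by
    intro p q i j
    have h := congrFun (congrFun hL (e p, i)) (e q, j)
    rw [← hvv]
    refine h.trans ?_
    rw [Matrix.sum_apply]
    rfl
  let K : Fin N → Matrix b a ℂ := fun l => Matrix.of fun i x => L l (e x, i)
  have hK : Φ.map = krausMap K := by
    refine Matrix.ext_linearMap _ fun p q => LinearMap.ext_ring ?_
    ext i j
    change Φ.map (Matrix.single p q 1) i j = krausMap K (Matrix.single p q 1) i j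
    rw [hΦ, krausMap_apply, Matrix.sum_apply]
    refine Finset.sum_congr rfl fun l _ => ?_
    simp [Matrix.mul_apply, Matrix.single_apply, K, ite_and]
  refine ⟨N, K, hK, ?_⟩
  ext p q
  -- The indices are swapped because `Tr (K E_qp K†)` is the `(p, q)` entry of `K† K`.
  have h := Φ.trace_preserving (Matrix.single q p (1 : ℂ))
  rw [hK, krausMap_apply, Matrix.trace_sum] at h
  have h1 : ∀ i, (K i * Matrix.single q p (1 : ℂ) * (K i).conjTranspose).trace =
      ((K i).conjTranspose * K i) p q := by
    intro i
    rw [Matrix.trace_mul_comm, ← Matrix.mul_assoc, Matrix.trace_mul_single]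
    simp
  simp only [h1] at h
  rw [Matrix.sum_apply, h, Matrix.one_apply]
  by_cases hpq : p = q
  · subst hpq; simp
  · simp [hpq, Matrix.trace_single_eq_of_ne, Ne.symm hpq]

theorem krausMap_apply_ketbra_diag {ι a b : Type} [Fintype ι] [Fintype a] (K : ι → Matrix b a ℂ)
    (ψ : a → ℂ) (s : b) :
    krausMap K (ketbra ψ) s s = ((∑ i, ‖(K i).mulVec ψ s‖ ^ 2 : ℝ) : ℂ) := by
  rw [krausMap_apply, Matrix.sum_apply, Complex.ofReal_sum]
  refine Finset.sum_congr rfl fun i _ => ?_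
  rw [ketbra, outer, Matrix.mul_vecMulVec, Matrix.vecMulVec_mul, ← Matrix.star_mulVec,
    Matrix.vecMulVec_apply, Pi.star_apply, Complex.ofReal_pow]
  exact Complex.mul_conj' _

theorem krausMap_comp {ι ι' a b c : Type} [Fintype ι] [Fintype ι'] [Fintype a] [Fintype b]
    (L : ι' → Matrix c b ℂ) (K : ι → Matrix b a ℂ) :
    krausMap L ∘ₗ krausMap K = krausMap fun p : ι × ι' => L p.2 * K p.1 := by
  ext1 ρ
  rw [LinearMap.comp_apply, krausMap_apply K, map_sum, krausMap_apply, Fintype.sum_prod_type]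
  refine Finset.sum_congr rfl fun i _ => ?_
  rw [krausMap_apply]
  refine Finset.sum_congr rfl fun j _ => ?_
  simp only [Matrix.conjTranspose_mul, Matrix.mul_assoc]

theorem mapTensor_krausMap {ι ι' a b c d : Type} [Fintype ι] [Fintype ι'] [Fintype a]
    [DecidableEq a] [Fintype c] [DecidableEq c] (K : ι → Matrix b a ℂ) (L : ι' → Matrix d c ℂ) :
    mapTensor (krausMap K) (krausMap L) = krausMap fun p : ι × ι' => K p.1 ⊗ₖ L p.2 := by
  refine Matrix.ext_linearMap _ fun p q => LinearMap.ext_ring ?_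
  change mapTensor (krausMap K) (krausMap L) (Matrix.single p q 1) =
    krausMap (fun p : ι × ι' => K p.1 ⊗ₖ L p.2) (Matrix.single p q 1)
  have h : Matrix.single p q (1 : ℂ) =
      Matrix.single p.1 q.1 (1 : ℂ) ⊗ₖ Matrix.single p.2 q.2 (1 : ℂ) := by
    rw [Matrix.single_kronecker_single, mul_one]
  rw [h, mapTensor_kronecker]
  simp only [krausMap_apply, Matrix.conjTranspose_kronecker, ← Matrix.mul_kronecker_mul]
  ext x y
  simp only [Matrix.kroneckerMap_apply, Matrix.sum_apply, Fintype.sum_prod_type,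
    Finset.sum_mul_sum]

/-- The Kraus operator that acts on the second register when the key register holds `k`. -/
def keyedKraus {κ : ℕ} {a b : Type} (K : Matrix b (Bits κ × a) ℂ) (k : Bits κ) : Matrix b a ℂ :=
  Matrix.of fun i x => K i (k, x)

theorem CPTP.keyed_eq_krausMap {ι : Type} [Fintype ι] {κ : ℕ} {a b : Type} [Fintype a]
    [Fintype b] (Φ : CPTP (Bits κ × a) b) (K : ι → Matrix b (Bits κ × a) ℂ)
    (hK : Φ.map = krausMap K) (k : Bits κ) :
    Φ.keyed k = krausMap fun i => keyedKraus (K i) k := by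
  ext1 ρ
  change Φ.map (ketbra (ket k) ⊗ₖ ρ) = _
  rw [hK, krausMap_apply, krausMap_apply]
  refine Finset.sum_congr rfl fun l _ => ?_
  ext i j
  simp [Matrix.mul_apply, Fintype.sum_prod_type, keyedKraus, ketbra, outer,
    Matrix.vecMulVec_apply, ket_apply, apply_ite]

theorem sum_keyedKraus {ι : Type} [Fintype ι] {κ : ℕ} {a b : Type} [DecidableEq a]
    [Fintype b] (K : ι → Matrix b (Bits κ × a) ℂ)
    (hK : ∑ i, (K i).conjTranspose * K i = 1) (k : Bits κ) :
    ∑ i, (keyedKraus (K i) k).conjTranspose * keyedKraus (K i) k = 1 := by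
  ext x y
  have h := congrFun (congrFun hK (k, x)) (k, y)
  rw [Matrix.sum_apply] at h ⊢
  refine h.trans ?_
  simp [Matrix.one_apply]

/-- The operator whose rows are the rows of index `m` of a family of Kraus operators. Its Gram
matrix is the effect of the outcome `m`. -/
def outcomeOp {ι a b : Type} (K : ι → Matrix b a ℂ) (m : b) : Matrix ι a ℂ :=
  Matrix.of fun i x => K i m x

/-- Grouping the rows of all Kraus operators by output index rather than by Kraus index leaves the
total Gram matrix unchanged; hence the outcomes form a measurement. -/
theorem sum_outcomeOp {ι a b : Type} [Fintype ι] [Fintype b] [DecidableEq a]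
    (K : ι → Matrix b a ℂ) (hK : ∑ i, (K i).conjTranspose * K i = 1) :
    ∑ m, (outcomeOp K m).conjTranspose * outcomeOp K m = 1 := by
  rw [← hK]
  ext x y
  simp only [Matrix.sum_apply, Matrix.mul_apply, Matrix.conjTranspose_apply, outcomeOp,
    Matrix.of_apply]
  exact Finset.sum_comm

/-- The trace of the Kraus completeness relation. -/
theorem sum_frobSq {ι a b : Type} [Fintype ι] [Fintype a] [DecidableEq a] [Fintype b]
    (K : ι → Matrix b a ℂ) (hK : ∑ i, (K i).conjTranspose * K i = 1) :
    ∑ i, frobSq (K i) = Fintype.card a := by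
  have h := congrArg Matrix.trace hK
  rw [Matrix.trace_one, Matrix.trace_sum] at h
  have h1 : ∀ i, ((K i).conjTranspose * K i).trace = (frobSq (K i) : ℂ) := by
    intro i
    simp only [frobSq, normSqVec, Matrix.trace, Matrix.diag, Matrix.mul_apply,
      Matrix.conjTranspose_apply, Fintype.sum_prod_type, Complex.ofReal_sum, Complex.ofReal_pow]
    rw [Finset.sum_comm]
    exact Finset.sum_congr rfl fun x _ => Finset.sum_congr rfl fun y _ => Complex.conj_mul' _
  simp only [h1] at h
  exact_mod_cast h

theorem ketbra_ket_mul_trace {a : Type} [Fintype a] [DecidableEq a] (s : a) (M : Op a) :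
    (ketbra (ket s) * M).trace = M s s := by
  simp [Matrix.trace, Matrix.mul_apply, ketbra, outer, Matrix.vecMulVec_apply, ket_apply,
    apply_ite]

/-! ### Wiesner states -/

/-- The product is the identity when the exponents agree and `H` otherwise, and every entry of `H`
has modulus `1/√2`. -/
theorem norm_hadamard_mul_hadamard_le (s t x y : Bool) :
    ‖(hadamard s * hadamard t) x y‖ ≤ if s = t then 1 else 1 / Real.sqrt 2 := by
  have h2 : (0 : ℝ) ≤ Real.sqrt 2 := Real.sqrt_nonneg 2
  by_cases h : s = t
  · subst h
    rw [hadamard_mul_self, if_pos rfl, Matrix.one_apply]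
    split_ifs <;> simp
  · rw [if_neg h]
    cases s <;> cases t <;> first | exact absurd rfl h | skip
    all_goals
      cases x <;> cases y <;>
        simp [hadamard, Matrix.mul_apply, abs_of_nonneg h2]

theorem hadamardPow_mul_apply {n : ℕ} (θ θ' x y : Bits n) :
    (hadamardPow θ * hadamardPow θ') x y =
      ∏ i, (hadamard (θ i) * hadamard (θ' i)) (x i) (y i) := by
  simp only [Matrix.mul_apply, hadamardPow, Matrix.of_apply, ← Finset.prod_mul_distrib]
  rw [← Fintype.prod_sum (fun i z => hadamard (θ i) (x i) z * hadamard (θ' i) z (y i))]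

theorem star_wiesner_dotProduct_eq {n : ℕ} (x θ y θ' : Bits n) :
    star (wiesner x θ) ⬝ᵥ wiesner y θ' = (hadamardPow θ * hadamardPow θ') x y := by
  rw [wiesner, wiesner, star_mulVec_dotProduct, conjTranspose_hadamardPow, Matrix.mulVec_mulVec]
  simp [dotProduct, Matrix.mulVec, ket_apply, apply_ite]

/-- The largest overlap of a vector of the basis `θ` and a vector of the basis `θ'`. -/
noncomputable def basisOverlap {n : ℕ} (θ θ' : Bits n) : ℝ :=
  ∏ i, if θ i = θ' i then 1 else 1 / Real.sqrt 2

theorem basisOverlap_nonneg {n : ℕ} (θ θ' : Bits n) : 0 ≤ basisOverlap θ θ' :=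
  Finset.prod_nonneg fun i _ => by split_ifs <;> positivity

theorem basisOverlap_comm {n : ℕ} (θ θ' : Bits n) : basisOverlap θ θ' = basisOverlap θ' θ := by
  simp only [basisOverlap, eq_comm]

theorem norm_star_wiesner_dotProduct_le {n : ℕ} (x θ y θ' : Bits n) :
    ‖star (wiesner x θ) ⬝ᵥ wiesner y θ'‖ ≤ basisOverlap θ θ' := by
  rw [star_wiesner_dotProduct_eq, hadamardPow_mul_apply, norm_prod]
  exact Finset.prod_le_prod (fun _ _ => norm_nonneg _)
    fun i _ => norm_hadamard_mul_hadamard_le _ _ _ _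

/-- The sum factors over the qubits, each giving `1` for the equal basis and `1/√2` for the other.
The value does not depend on `θ`, as `monogamy_bound` requires. -/
theorem sum_basisOverlap {n : ℕ} (θ : Bits n) :
    ∑ θ', basisOverlap θ θ' = (1 + 1 / Real.sqrt 2) ^ n := by
  simp only [basisOverlap]
  rw [← Fintype.prod_sum (fun i b => if θ i = b then (1 : ℝ) else 1 / Real.sqrt 2)]
  have h : ∀ i, ∑ b, (if θ i = b then (1 : ℝ) else 1 / Real.sqrt 2) = 1 + 1 / Real.sqrt 2 := by
    intro i
    cases θ i <;> simp [add_comm]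
  simp only [h, Finset.prod_const, Finset.card_univ, Fintype.card_fin]

/-! ### Cloning attacks on conjugate encryption -/

theorem conjugateEncryption_keyProb (lam : ℕ+) (k : Bits (conjugateEncryption.κ lam)) :
    conjugateEncryption.keyProb lam k = 1 / 2 ^ ((lam : ℕ) + lam) := by
  let k' : Bits ((lam : ℕ) + lam) := k
  change (ketbra (ket k') * (conjKey lam).map 1).trace.re = _
  rw [conjKey_map_one, sum_ketbra_ket, ketbra_ket_mul_trace, Matrix.smul_apply,
    Matrix.one_apply_eq, smul_eq_mul, mul_one]
  have h : (1 / 2 ^ ((lam : ℕ) + lam) : ℂ) = ((1 / 2 ^ ((lam : ℕ) + lam) : ℝ) : ℂ) := by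
    push_cast
    rfl
  rw [h, Complex.ofReal_re]

theorem bxor_bxor_self {n : ℕ} (x r : Bits n) : bxor (bxor x r) r = x := by
  funext i
  simp [bxor]

/-- The exclusive or with a fixed string, as a permutation. -/
def bxorEquiv {n : ℕ} (r : Bits n) : Bits n ≃ Bits n where
  toFun x := bxor x r
  invFun x := bxor x r
  left_inv x := bxor_bxor_self x r
  right_inv x := bxor_bxor_self x r

/-- A key of conjugate encryption as a pair `(r, θ)`. -/
def keyEquiv (n : ℕ) : Bits n × Bits n ≃ Bits (n + n) where
  toFun p := Fin.append p.1 p.2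
  invFun k := (keyR k, keyθ k)
  left_inv p := by
    exact Prod.ext (funext fun i => Fin.append_left _ _ i) (funext fun i => Fin.append_right _ _ i)
  right_inv k := Fin.append_castAdd_natAdd

theorem keyR_keyEquiv {n : ℕ} (p : Bits n × Bits n) : keyR (keyEquiv n p) = p.1 :=
  congrArg Prod.fst ((keyEquiv n).symm_apply_apply p)

theorem keyθ_keyEquiv {n : ℕ} (p : Bits n × Bits n) : keyθ (keyEquiv n p) = p.2 :=
  congrArg Prod.snd ((keyEquiv n).symm_apply_apply p)

/-- The probability that both parties output `m`, in terms of Kraus operators. -/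
theorem trace_mapTensor_krausMap {I J L B C E M : Type} [Fintype I] [Fintype J] [Fintype L]
    [Fintype B] [DecidableEq B] [Fintype C] [DecidableEq C] [Fintype E] [Fintype M]
    [DecidableEq M] (KB : I → Matrix M B ℂ) (KC : J → Matrix M C ℂ) (KA : L → Matrix (B × C) E ℂ)
    (ψ : E → ℂ) (m : M) :
    ((ketbra (ket m) ⊗ₖ ketbra (ket m)) *
      mapTensor (krausMap KB) (krausMap KC) (krausMap KA (ketbra ψ))).trace.re =
      ∑ l, normSqVec ((outcomeOp KB m ⊗ₖ outcomeOp KC m).mulVec ((KA l).mulVec ψ)) := by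
  rw [← ketbra_ket_prod (m, m), ketbra_ket_mul_trace, mapTensor_krausMap, ← LinearMap.comp_apply,
    krausMap_comp, krausMap_apply_ketbra_diag, Complex.ofReal_re, Fintype.sum_prod_type]
  refine Finset.sum_congr rfl fun l _ => Finset.sum_congr rfl fun p _ => ?_
  rw [← Matrix.mulVec_mulVec]
  rfl

/-- The guessing game with bases `θ` and outcomes `x`, for fixed Kraus operators. -/
theorem sum_conj_game_le {n : ℕ} {B C I J L : Type} [Fintype B] [DecidableEq B] [Fintype C]
    [DecidableEq C] [Fintype I] [DecidableEq I] [Fintype J] [DecidableEq J] [Fintype L]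
    (F : Bits n → Bits n → Matrix I B ℂ) (G : Bits n → Bits n → Matrix J C ℂ)
    (hF : ∀ θ, ∑ x, (F θ x).conjTranspose * F θ x = 1)
    (hG : ∀ θ, ∑ x, (G θ x).conjTranspose * G θ x = 1)
    (K : L → Matrix (B × C) (Bits n) ℂ) (hK : ∑ l, (K l).conjTranspose * K l = 1) :
    ∑ θ, ∑ x, ∑ l, normSqVec ((F θ x ⊗ₖ G θ x).mulVec ((K l).mulVec (wiesner x θ))) ≤
      (1 + 1 / Real.sqrt 2) ^ n * 2 ^ n := by
  have hcard := sum_frobSq K hK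
  rw [Fintype.card_fun, Fintype.card_bool, Fintype.card_fin] at hcard
  push_cast at hcard
  -- The dimension `2^n` is spread back over the Kraus operators of `A` and their index is brought
  -- outermost, so that the monogamy bound applies to each one.
  rw [← hcard, Finset.mul_sum, Finset.sum_congr rfl fun _ _ => Finset.sum_comm, Finset.sum_comm]
  exact Finset.sum_le_sum fun l _ => monogamy_bound (fun θ x => wiesner x θ) F G hF hG basisOverlap
    (fun θ θ' x y => (norm_star_wiesner_dotProduct_le y θ' x θ).trans_eq (basisOverlap_comm _ _))
    basisOverlap_nonneg basisOverlap_comm _ (by positivity) sum_basisOverlap (K l)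

/-- The value of the cloning game of conjugate encryption on `n` qubits. -/
theorem sum_conj_cloning_le {n β γ : ℕ} (A : CPTP (Bits n) (Bits β × Bits γ))
    (B : CPTP (Bits (n + n) × Bits β) (Bits n)) (C : CPTP (Bits (n + n) × Bits γ) (Bits n)) :
    ∑ m : Bits n, ∑ k : Bits (n + n), ((ketbra (ket m) ⊗ₖ ketbra (ket m)) *
      mapTensor (B.keyed k) (C.keyed k)
        (A.map ((conjEnc n).keyed k (ketbra (ket m))))).trace.re ≤
      2 ^ n * ((1 + 1 / Real.sqrt 2) ^ n * 2 ^ n) := by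
  obtain ⟨NA, KA, hA, hA1⟩ := A.exists_kraus
  obtain ⟨NB, KB, hB, hB1⟩ := B.exists_kraus
  obtain ⟨NC, KC, hC, hC1⟩ := C.exists_kraus
  let F : Bits (n + n) → Bits n → Matrix (Fin NB) (Bits β) ℂ :=
    fun k m => outcomeOp (fun i => keyedKraus (KB i) k) m
  let G : Bits (n + n) → Bits n → Matrix (Fin NC) (Bits γ) ℂ :=
    fun k m => outcomeOp (fun i => keyedKraus (KC i) k) m
  have hF : ∀ k, ∑ m, (F k m).conjTranspose * F k m = 1 :=
    fun k => sum_outcomeOp _ (sum_keyedKraus KB hB1 k)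
  have hG : ∀ k, ∑ m, (G k m).conjTranspose * G k m = 1 :=
    fun k => sum_outcomeOp _ (sum_keyedKraus KC hC1 k)
  have hterm : ∀ (m : Bits n) (k : Bits (n + n)),
      ((ketbra (ket m) ⊗ₖ ketbra (ket m)) * mapTensor (B.keyed k) (C.keyed k)
        (A.map ((conjEnc n).keyed k (ketbra (ket m))))).trace.re =
      ∑ l, normSqVec ((F k m ⊗ₖ G k m).mulVec
        ((KA l).mulVec (wiesner (bxor m (keyR k)) (keyθ k)))) := by
    intro m k
    rw [B.keyed_eq_krausMap KB hB, C.keyed_eq_krausMap KC hC, hA, conjEnc_keyed]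
    exact trace_mapTensor_krausMap _ _ _ _ _
  -- Both parties receive `r` with the key, so guessing `m` amounts to guessing `x = m ⊕ r`:
  -- permuting the outcomes of their measurements gives the game without `r`.
  have hgame : ∀ r : Bits n, ∑ θ : Bits n, ∑ m : Bits n, ∑ l,
      normSqVec ((F (keyEquiv n (r, θ)) m ⊗ₖ G (keyEquiv n (r, θ)) m).mulVec
        ((KA l).mulVec (wiesner (bxor m r) θ))) ≤ (1 + 1 / Real.sqrt 2) ^ n * 2 ^ n := by
    intro r
    refine le_trans (le_of_eq (Finset.sum_congr rfl fun θ _ => ?_)) (sum_conj_game_le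
      (fun θ x => F (keyEquiv n (r, θ)) (bxor x r)) (fun θ x => G (keyEquiv n (r, θ)) (bxor x r))
      (fun θ => ((bxorEquiv r).sum_comp fun m => (F (keyEquiv n (r, θ)) m).conjTranspose *
        F (keyEquiv n (r, θ)) m).trans (hF _))
      (fun θ => ((bxorEquiv r).sum_comp fun m => (G (keyEquiv n (r, θ)) m).conjTranspose *
        G (keyEquiv n (r, θ)) m).trans (hG _)) KA hA1)
    rw [← (bxorEquiv r).sum_comp]
    refine Finset.sum_congr rfl fun x _ => ?_
    change ∑ l, normSqVec ((F (keyEquiv n (r, θ)) (bxor x r) ⊗ₖ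
      G (keyEquiv n (r, θ)) (bxor x r)).mulVec
        ((KA l).mulVec (wiesner (bxor (bxor x r) r) θ))) = _
    rw [bxor_bxor_self]
  simp only [hterm]
  rw [Finset.sum_comm, ← (keyEquiv n).sum_comp, Fintype.sum_prod_type]
  simp only [keyR_keyEquiv, keyθ_keyEquiv]
  refine (Finset.sum_le_sum fun r _ => hgame r).trans_eq ?_
  rw [Finset.sum_const, Finset.card_univ, Fintype.card_fun, Fintype.card_bool, Fintype.card_fin,
    nsmul_eq_mul]
  push_cast
  rfl

/-- With `n = λ`, the weights `2^(-n)` for messages and `2^(-2n)` for keys meet the bound `2^n (1 +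
1/√2)^n 2^n`, leaving a single factor `2^(-n)`. -/
theorem conjugateEncryption_winProb_le (𝒜 : CloningAttack conjugateEncryption) (lam : ℕ+) :
    𝒜.winProb lam ≤ (1 / 2 + 1 / (2 * Real.sqrt 2)) ^ (lam : ℕ) := by
  have h := sum_conj_cloning_le (n := (lam : ℕ)) (𝒜.A lam) (𝒜.B lam) (𝒜.C lam)
  rw [CloningAttack.winProb]
  simp only [conjugateEncryption_keyProb, ← Finset.mul_sum]
  refine (mul_le_mul_of_nonneg_left (mul_le_mul_of_nonneg_left h (by positivity))
    (by positivity)).trans_eq ?_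
  change 1 / 2 ^ (lam : ℕ) * (1 / 2 ^ ((lam : ℕ) + lam) * _) = _
  have h2 : 1 / 2 + 1 / (2 * Real.sqrt 2) = (1 + 1 / Real.sqrt 2) / 2 := by ring
  rw [h2, div_pow, pow_add]
  field_simp

theorem two_rpow_uncloneable_exponent (n : ℕ) :
    (2 : ℝ) ^ (-(n : ℝ) + (n : ℝ) * Real.logb 2 (1 + 1 / Real.sqrt 2)) =
      (1 / 2 + 1 / (2 * Real.sqrt 2)) ^ n := by
  rw [Real.rpow_add two_pos, Real.rpow_neg two_pos.le, Real.rpow_natCast, mul_comm (n : ℝ),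
    Real.rpow_mul two_pos.le, Real.rpow_logb two_pos (by norm_num) (by positivity),
    Real.rpow_natCast, ← inv_pow, ← mul_pow]
  congr 1
  ring

end QuantumEnc

theorem mainTheorem4 :
    QuantumEnc.conjugateEncryption.UncloneableSecure
        (fun lam => ((lam : ℕ) : ℝ) * Real.logb 2 (1 + 1 / Real.sqrt 2)) ∧
      ∀ (𝒜 : QuantumEnc.CloningAttack QuantumEnc.conjugateEncryption) (lam : ℕ+),
        𝒜.winProb lam ≤ (1 / 2 + 1 / (2 * Real.sqrt 2)) ^ (lam : ℕ) := by
  -- The bound is exactly `2^(-n + t)`, so the negligible function can be zero.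
  refine ⟨fun 𝒜 => ⟨fun _ => 0, fun c => ⟨1, fun lam _ => ?_⟩, fun lam => ?_⟩,
    QuantumEnc.conjugateEncryption_winProb_le⟩
  · rw [abs_zero]
    positivity
  · refine (QuantumEnc.conjugateEncryption_winProb_le 𝒜 lam).trans_eq ?_
    rw [add_zero]
    exact (QuantumEnc.two_rpow_uncloneable_exponent lam).symm
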